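/- Let $d\in\mathbb{N}$, $-\infty<a<b<+\infty$, $\xi\in\mathbb{R}^d$, $p\in[2,+\infty)$, $\varrho\in(0,1]$, and let $\|\cdot\|$ be the Euclidean norm on $\mathbb{R}^d$. Let $f:[a,b]\times\mathbb{R}^d\to\mathbb{R}^d$ satisfy: (A1) $f$ is continuous on $[a,b]\times\mathbb{R}^d$; (A2) there is $K\in[0,+\infty)$ such that $\|f(t,y)\|\le K(1+\|y\|)$ for all $t\in[a,b]$, $y\in\mathbb{R}^d$; (A3) for every $R>0$ there is $L_R\in[0,+\infty)$ such that $\|f(t,x)-f(t,y)\|\le L_R\|x-y\|$ for all $t\in[a,b]$ and all $x,y\in\mathbb{R}^d$ with $\|x\|\le R$, $\|y\|\le R$; (A4) for every $H>0$ there is $\tilde L_H\in[0,+\infty)$ such that $\|f(t,x)-f(s,x)\|\le \tilde L_H|t-s|^{\varrho}$ for all $t,s\in[a,b]$ and all $x\in\mathbb{R}^d$ with $\|x\|\le H$. Let $(\tau_j)_{j\ge 0}$ be independent random variables on a probability space $(\Omega,\Sigma,\mathbb{P})$, each uniformly distributed on $[0,1]$. For $n\in\mathbb{N}$, $n\ge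 1$, put $h=(b-a)/n$, $t_k=a+kh$, $\theta_k=t_k+h\tau_k$, and define the randomized Euler scheme by $$y_0=\xi,\qquad y_{k+1}=y_k+hf(\theta_k,y_k),\quad k=0,1,\ldots,n-1,$$ and its piecewise linear interpolation by $l_n(t)=y_k+(t-t_k)f(\theta_k,y_k)$ for $t\in[t_k,t_{k+1}]$, $k=0,1,\ldots,n-1$. Then the initial value problem $z'(t)=f(t,z(t))$, $t\in[a,b]$, $z(a)=\xi$, has a unique solution $z$ on $[a,b]$, and there exists $C\in[0,+\infty)$ such that for all $n\ge 1$ the quantity $\sup_{a\le t\le b}\|z(t)-l_n(t)\|$ is ($\mathbb{P}$-almost everywhere equal to) a random variable and $$\Bigl\|\sup_{a\le t\le b}\|z(t)-l_n(t)\|\Bigr\|_{L^p(\Omega)}\le C\,h^{\min\{\varrho+\frac12,\,1\}}.$$ -/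

import Mathlib

open MeasureTheory ProbabilityTheory Set
open scoped ENNReal

noncomputable section

namespace RandEuler

/-- `z` solves `z'(t) = f(t, z(t))` on `[a,b]`, `z(a) = ξ` (one-sided derivatives at the
end points). -/
def IsSolution {d : ℕ} (a b : ℝ) (f : ℝ → EuclideanSpace ℝ (Fin d) → EuclideanSpace ℝ (Fin d))
    (ξ : EuclideanSpace ℝ (Fin d)) (z : ℝ → EuclideanSpace ℝ (Fin d)) : Prop :=
  z a = ξ ∧ ∀ t ∈ Icc a b, HasDerivWithinAt z (f t (z t)) (Icc a b) t

/-- The step size `h = (b - a) / n`. -/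
def step (a b : ℝ) (n : ℕ) : ℝ := (b - a) / n

/-- The grid point `t_k = a + k h`. -/
def grid (a b : ℝ) (n k : ℕ) : ℝ := a + k * step a b n

/-- The random evaluation point `θ_k = t_k + h τ_k`, for a realization `τ` of the
random sequence. -/
def node (a b : ℝ) (n : ℕ) (τ : ℕ → ℝ) (k : ℕ) : ℝ := grid a b n k + step a b n * τ k

/-- The randomized Euler scheme: `y_0 = ξ`, `y_{k+1} = y_k + h f(θ_k, y_k)`. -/
def euler {d : ℕ} (a b : ℝ) (f : ℝ → EuclideanSpace ℝ (Fin d) → EuclideanSpace ℝ (Fin d))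
    (ξ : EuclideanSpace ℝ (Fin d)) (n : ℕ) (τ : ℕ → ℝ) : ℕ → EuclideanSpace ℝ (Fin d)
  | 0 => ξ
  | k + 1 => euler a b f ξ n τ k + step a b n • f (node a b n τ k) (euler a b f ξ n τ k)

/-- The linear piece `l_{k,n}(t) = y_k + (t - t_k) f(θ_k, y_k)`. -/
def piece {d : ℕ} (a b : ℝ) (f : ℝ → EuclideanSpace ℝ (Fin d) → EuclideanSpace ℝ (Fin d))
    (ξ : EuclideanSpace ℝ (Fin d)) (n : ℕ) (τ : ℕ → ℝ) (k : ℕ) (t : ℝ) :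
    EuclideanSpace ℝ (Fin d) :=
  euler a b f ξ n τ k +
    (t - grid a b n k) • f (node a b n τ k) (euler a b f ξ n τ k)

/-- The continuous piecewise linear approximation `l_n`. The index `min ⌊(t - a)/h⌋ (n - 1)`
selects, for `t ∈ [a,b]`, some `k < n` with `t ∈ [t_k, t_{k+1}]`; by `interp_eq_piece` the choice
at common end points is immaterial. -/
def interp {d : ℕ} (a b : ℝ) (f : ℝ → EuclideanSpace ℝ (Fin d) → EuclideanSpace ℝ (Fin d))
    (ξ : EuclideanSpace ℝ (Fin d)) (n : ℕ) (τ : ℕ → ℝ) (t : ℝ) : EuclideanSpace ℝ (Fin d) :=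
  piece a b f ξ n τ (min ⌊(t - a) / step a b n⌋₊ (n - 1)) t

/-- `l_n(t) = l_{k,n}(t)` for `t ∈ [t_k, t_{k+1}]`, `k = 0, …, n - 1`. -/
theorem interp_eq_piece {d : ℕ} {a b : ℝ} (hab : a < b)
    (f : ℝ → EuclideanSpace ℝ (Fin d) → EuclideanSpace ℝ (Fin d))
    (ξ : EuclideanSpace ℝ (Fin d)) {n : ℕ} (τ : ℕ → ℝ) {k : ℕ} (hk : k < n) {t : ℝ}
    (ht : t ∈ Icc (grid a b n k) (grid a b n (k + 1))) :
    interp a b f ξ n τ t = piece a b f ξ n τ k t := by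
  have hn : (0 : ℝ) < n := by exact_mod_cast (Nat.zero_le k).trans_lt hk
  have hh : 0 < step a b n := div_pos (sub_pos.2 hab) hn
  obtain ⟨h1, h2⟩ := ht
  rcases h2.lt_or_eq with h2 | h2
  · have hfl : ⌊(t - a) / step a b n⌋₊ = k := by
      have h0 : 0 ≤ (k : ℝ) * step a b n := mul_nonneg k.cast_nonneg hh.le
      unfold grid at h1 h2
      rw [Nat.floor_eq_iff (div_nonneg (by linarith) hh.le)]
      push_cast at h2
      constructor
      · rw [le_div_iff₀ hh]; linarith
      · rw [div_lt_iff₀ hh]; linarith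
    unfold interp
    rw [hfl, min_eq_left (by omega)]
  · have hfl : ⌊(t - a) / step a b n⌋₊ = k + 1 := by
      have : (t - a) / step a b n = ((k + 1 : ℕ) : ℝ) := by
        rw [h2, grid, add_sub_cancel_left, mul_div_cancel_right₀ _ hh.ne']
      rw [this, Nat.floor_natCast]
    unfold interp
    rw [hfl]
    by_cases hkn : k + 1 = n
    · rw [min_eq_right (by omega)]
      congr 1
      omega
    · rw [min_eq_left (by omega)]
      have e : t - grid a b n k = step a b n := by
        rw [h2]; unfold grid; push_cast; ring
      unfold piece
      rw [e, h2, sub_self, zero_smul, add_zero, euler]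

end RandEuler

end

/-!
Replacing the field by a truncation outside a large ball changes neither the solution nor the
scheme, since linear growth bounds both a priori; hence the field may be taken bounded, globally
Lipschitz in space and Hölder continuous in time. The error of the scheme is then driven by the
quadrature errors `∫ g(s, z(t_k)) ds - h g(θ_k, z(t_k))` over the cells of the grid, taken along
the exact solution. These are independent, centred and of size `O(h^(ϱ+1))`. Doob's inequality for
the exponentials of their partial sums yields a Gaussian tail for the maximum of these sums, whose
`L^p` norm is therefore `O(√n h^(ϱ+1)) = O(h^(ϱ+1/2))`. A discrete Gronwall argument transfers
this bound to the scheme at the cost of an additional `O(h)`.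
-/

namespace RandEuler

open scoped NNReal

section MaximalInequality

variable {Ω : Type*} {mΩ : MeasurableSpace Ω} {P : Measure Ω}

theorem submartingale_convexOn_comp {ι : Type*} [Preorder ι] [IsFiniteMeasure P]
    {ℱ : Filtration ι mΩ} {f : ι → Ω → ℝ} (hf : Martingale f ℱ P) {φ : ℝ → ℝ}
    (hφ : ConvexOn ℝ univ φ) (hint : ∀ i, Integrable (φ ∘ f i) P) :
    Submartingale (fun i ↦ φ ∘ f i) ℱ P := by
  have hcont : Continuous φ := continuousOn_univ.1 (hφ.continuousOn isOpen_univ)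
  refine ⟨fun i ↦ hcont.comp_stronglyMeasurable (hf.stronglyAdapted i), fun i j hij ↦ ?_, hint⟩
  filter_upwards [hφ.map_condExp_le_univ (ℱ.le i) hcont.lowerSemicontinuous (hf.integrable j)
    (hint j), hf.condExp_ae_eq hij] with ω hJensen hmart
  rwa [Function.comp_apply, hmart] at hJensen

theorem martingale_sum_range {E : Type*} [NormedAddCommGroup E] [NormedSpace ℝ E] [CompleteSpace E]
    [SecondCountableTopology E] [MeasurableSpace E] [BorelSpace E] {X : ℕ → Ω → E}
    (hX : ∀ j, StronglyMeasurable (X j)) (hindep : iIndepFun X P) (hint : ∀ j, Integrable (X j) P)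
    (hmean : ∀ j, ∫ ω, X j ω ∂P = 0) :
    Martingale (fun k ω ↦ ∑ j ∈ Finset.range (k + 1), X j ω) (Filtration.natural X hX) P := by
  have := hindep.isProbabilityMeasure
  set ℱ := Filtration.natural X hX
  have hadapted : StronglyAdapted ℱ fun k ω ↦ ∑ j ∈ Finset.range (k + 1), X j ω := fun k ↦
    Finset.stronglyMeasurable_fun_sum _ fun j hj ↦ (Filtration.stronglyAdapted_natural hX j).mono
      (ℱ.mono (Nat.lt_succ_iff.1 (Finset.mem_range.1 hj)))
  have hsum_int : ∀ k, Integrable (fun ω ↦ ∑ j ∈ Finset.range k, X j ω) P := fun k ↦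
    integrable_finsetSum _ fun j _ ↦ hint j
  refine martingale_nat hadapted (fun k ↦ hsum_int _) fun k ↦ ?_
  have hsucc : (fun ω ↦ ∑ j ∈ Finset.range (k + 1 + 1), X j ω) =
      (fun ω ↦ ∑ j ∈ Finset.range (k + 1), X j ω) + X (k + 1) :=
    funext fun ω ↦ Finset.sum_range_succ _ _
  have hpast := condExp_of_stronglyMeasurable (ℱ.le k) (hadapted k) (hsum_int (k + 1))
  have hincr := hindep.condExp_natural_ae_eq_of_lt hX k.lt_succ_self
  rw [hsucc]
  filter_upwards [condExp_add (hsum_int (k + 1)) (hint (k + 1)) (ℱ k), hincr] with ω hadd hω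
  rw [hadd, Pi.add_apply, hpast, hω, hmean, add_zero]

theorem mul_measureReal_exists_le_le_integral [IsFiniteMeasure P] {ℱ : Filtration ℕ mΩ}
    {f : ℕ → Ω → ℝ} (hf : Submartingale f ℱ P) (hnonneg : 0 ≤ f) {ε : ℝ} (hε : 0 ≤ ε) (n : ℕ) :
    ε * P.real {ω | ∃ k ≤ n, ε ≤ f k ω} ≤ ∫ ω, f n ω ∂P := by
  have hmax := maximal_ineq hf hnonneg (ε := ⟨ε, hε⟩) n
  simp only [Finset.le_sup'_iff, Finset.mem_range, Nat.lt_succ_iff] at hmax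
  have hset : ∫ ω in {ω | ∃ k ≤ n, ε ≤ f k ω}, f n ω ∂P ≤ ∫ ω, f n ω ∂P :=
    setIntegral_le_integral (hf.integrable n) (ae_of_all _ (hnonneg n))
  have hreal := ENNReal.toReal_mono ENNReal.ofReal_ne_top
    (hmax.trans (ENNReal.ofReal_le_ofReal hset))
  rwa [ENNReal.toReal_mul, ENNReal.toReal_ofReal (integral_nonneg (hnonneg n))] at hreal

section Real

variable {X : ℕ → Ω → ℝ} {c : ℕ → ℝ≥0}

theorem measureReal_exists_le_sum_range_le_exp_add (hX : ∀ j, Measurable (X j))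
    (hindep : iIndepFun X P) (hsub : ∀ j, HasSubgaussianMGF (X j) (c j) P)
    (hmean : ∀ j, ∫ ω, X j ω ∂P = 0) {ε r : ℝ} (hε : 0 < ε) (hr : 0 ≤ r) (n : ℕ) :
    P.real {ω | ∃ k ≤ n, ε ≤ ∑ j ∈ Finset.range k, X j ω} ≤
      Real.exp (-(r * ε) + (∑ j ∈ Finset.range n, c j : ℝ≥0) * r ^ 2 / 2) := by
  have := hindep.isProbabilityMeasure
  rcases n with _ | n
  · simp [hε.not_ge, Real.exp_nonneg]
  set S : ℕ → Ω → ℝ := fun k ω ↦ ∑ j ∈ Finset.range k, X j ω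
  have hsum : ∀ k, HasSubgaussianMGF (S k) (∑ j ∈ Finset.range k, c j) P := fun k ↦
    HasSubgaussianMGF.sum_of_iIndepFun hindep fun j _ ↦ hsub j
  have hconv : ConvexOn ℝ univ fun x : ℝ ↦ Real.exp (r * x) := by
    simpa [Function.comp_def] using convexOn_exp.comp_linearMap (LinearMap.lsmul ℝ ℝ r)
  have hsubmart := submartingale_convexOn_comp
    (martingale_sum_range (fun j ↦ (hX j).stronglyMeasurable) hindep
      (fun j ↦ (hsub j).integrable) hmean)
    hconv fun k ↦ (hsum (k + 1)).integrable_exp_mul r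
  have hsubset : {ω | ∃ k ≤ n + 1, ε ≤ S k ω} ⊆
      {ω | ∃ k ≤ n, Real.exp (r * ε) ≤ Real.exp (r * S (k + 1) ω)} := by
    rintro ω ⟨_ | k, hk, hεk⟩
    · simp [S, hε.not_ge] at hεk
    · exact ⟨k, by omega, Real.exp_le_exp.2 (mul_le_mul_of_nonneg_left hεk hr)⟩
  have hDoob := mul_measureReal_exists_le_le_integral hsubmart (fun _ _ ↦ (Real.exp_pos _).le)
    (Real.exp_pos (r * ε)).le n
  calc P.real {ω | ∃ k ≤ n + 1, ε ≤ S k ω}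
      ≤ Real.exp (-(r * ε)) * (Real.exp (r * ε) *
          P.real {ω | ∃ k ≤ n, Real.exp (r * ε) ≤ Real.exp (r * S (k + 1) ω)}) := by
        rw [← mul_assoc, ← Real.exp_add, neg_add_cancel, Real.exp_zero, one_mul]
        exact measureReal_mono hsubset
    _ ≤ Real.exp (-(r * ε)) * Real.exp ((∑ j ∈ Finset.range (n + 1), c j : ℝ≥0) * r ^ 2 / 2) := by
        gcongr
        exact hDoob.trans ((hsum (n + 1)).mgf_le r)
    _ = _ := (Real.exp_add _ _).symm

/-- If all the `c j` vanish, the right-hand side is the trivial bound `1`, as `x / 0 = 0`. -/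
theorem measureReal_exists_le_sum_range_le (hX : ∀ j, Measurable (X j))
    (hindep : iIndepFun X P) (hsub : ∀ j, HasSubgaussianMGF (X j) (c j) P)
    (hmean : ∀ j, ∫ ω, X j ω ∂P = 0) {ε : ℝ} (hε : 0 < ε) (n : ℕ) :
    P.real {ω | ∃ k ≤ n, ε ≤ ∑ j ∈ Finset.range k, X j ω} ≤
      Real.exp (-ε ^ 2 / (2 * (∑ j ∈ Finset.range n, c j : ℝ≥0))) := by
  set v := ∑ j ∈ Finset.range n, c j
  -- `r = ε / v` minimizes the exponent `-r ε + v r² / 2`.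
  refine (measureReal_exists_le_sum_range_le_exp_add hX hindep hsub hmean hε
    (div_nonneg hε.le v.coe_nonneg) n).trans_eq (congrArg Real.exp ?_)
  change -(ε / v * ε) + v * (ε / v) ^ 2 / 2 = _
  rcases eq_or_ne (v : ℝ) 0 with hv | hv
  · simp [hv]
  · field_simp
    ring

theorem measureReal_exists_le_abs_sum_range_le (hX : ∀ j, Measurable (X j))
    (hindep : iIndepFun X P) (hsub : ∀ j, HasSubgaussianMGF (X j) (c j) P)
    (hmean : ∀ j, ∫ ω, X j ω ∂P = 0) {ε : ℝ} (hε : 0 < ε) (n : ℕ) :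
    P.real {ω | ∃ k ≤ n, ε ≤ |∑ j ∈ Finset.range k, X j ω|} ≤
      2 * Real.exp (-ε ^ 2 / (2 * (∑ j ∈ Finset.range n, c j : ℝ≥0))) := by
  have := hindep.isProbabilityMeasure
  have hupper := measureReal_exists_le_sum_range_le hX hindep hsub hmean hε n
  have hlower := measureReal_exists_le_sum_range_le (fun j ↦ (hX j).neg)
    (hindep.comp (fun _ ↦ Neg.neg) fun _ ↦ measurable_neg) (fun j ↦ (hsub j).neg)
    (fun j ↦ by simp [integral_neg, hmean]) hε n
  have hsubset : {ω | ∃ k ≤ n, ε ≤ |∑ j ∈ Finset.range k, X j ω|} ⊆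
      {ω | ∃ k ≤ n, ε ≤ ∑ j ∈ Finset.range k, X j ω} ∪
        {ω | ∃ k ≤ n, ε ≤ ∑ j ∈ Finset.range k, (-X j) ω} := by
    rintro ω ⟨k, hk, hεk⟩
    rcases le_abs.1 hεk with h | h
    · exact Or.inl ⟨k, hk, h⟩
    · exact Or.inr ⟨k, hk, by simpa using h⟩
  calc _ ≤ _ := measureReal_mono hsubset
    _ ≤ _ := measureReal_union_le _ _
    _ ≤ _ := add_le_add hupper hlower
    _ = _ := (two_mul _).symm

end Real

section Vector

variable {ι : Type*} [Fintype ι]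

theorem exists_div_sqrt_card_le_abs_apply {v : EuclideanSpace ℝ ι} {ε : ℝ} (hε : 0 < ε)
    (hv : ε ≤ ‖v‖) : ∃ i, ε / √(Fintype.card ι) ≤ |v i| := by
  have : Nonempty ι := by
    by_contra hempty
    have := not_nonempty_iff.1 hempty
    simp [Subsingleton.elim v 0, hε.not_ge] at hv
  have hcard : (0 : ℝ) < Fintype.card ι := by exact_mod_cast Fintype.card_pos
  have hsum : ∑ _i : ι, ε ^ 2 / Fintype.card ι ≤ ∑ i, |v i| ^ 2 := by
    simpa [Finset.card_univ, mul_div_cancel₀ _ hcard.ne', EuclideanSpace.real_norm_sq_eq] using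
      pow_le_pow_left₀ hε.le hv 2
  obtain ⟨i, -, hi⟩ := Finset.exists_le_of_sum_le Finset.univ_nonempty hsum
  refine ⟨i, le_of_sq_le_sq ?_ (abs_nonneg _)⟩
  rwa [div_pow, Real.sq_sqrt hcard.le]

theorem hasSubgaussianMGF_of_abs_le [IsProbabilityMeasure P] {Y : Ω → ℝ} (hY : AEMeasurable Y P)
    {r : ℝ≥0} (hbound : ∀ᵐ ω ∂P, |Y ω| ≤ r) (hmean : ∫ ω, Y ω ∂P = 0) :
    HasSubgaussianMGF Y (r ^ 2) P := by
  convert hasSubgaussianMGF_of_mem_Icc_of_integral_eq_zero hY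
    (hbound.mono fun ω hω ↦ abs_le.1 hω) hmean using 1
  ext
  simp [← two_mul]

theorem measureReal_exists_le_norm_sum_range_le {X : ℕ → Ω → EuclideanSpace ℝ ι}
    (hX : ∀ j, Measurable (X j)) (hindep : iIndepFun X P) (hmean : ∀ j, ∫ ω, X j ω ∂P = 0)
    {r : ℕ → ℝ≥0} (hbound : ∀ j, ∀ᵐ ω ∂P, ‖X j ω‖ ≤ r j) {ε : ℝ} (hε : 0 < ε) (n : ℕ) :
    P.real {ω | ∃ k ≤ n, ε ≤ ‖∑ j ∈ Finset.range k, X j ω‖} ≤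
      2 * Fintype.card ι *
        Real.exp (-ε ^ 2 / (2 * Fintype.card ι * (∑ j ∈ Finset.range n, r j ^ 2 : ℝ≥0))) := by
  have := hindep.isProbabilityMeasure
  set δ := ε / √(Fintype.card ι)
  have hcoord_meas : ∀ i, Measurable fun v : EuclideanSpace ℝ ι ↦ v i := fun i ↦ by fun_prop
  have hcoord_mean : ∀ i j, ∫ ω, X j ω i ∂P = 0 := fun i j ↦ by
    simpa [hmean j] using (EuclideanSpace.proj (𝕜 := ℝ) i).integral_comp_comm
      (Integrable.of_bound (hX j).aestronglyMeasurable (r j) (hbound j))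
  have hcoord : ∀ i, P.real {ω | ∃ k ≤ n, δ ≤ |∑ j ∈ Finset.range k, X j ω i|} ≤
      2 * Real.exp (-ε ^ 2 / (2 * Fintype.card ι * (∑ j ∈ Finset.range n, r j ^ 2 : ℝ≥0))) := by
    intro i
    have hcard : (0 : ℝ) < Fintype.card ι := by exact_mod_cast Fintype.card_pos_iff.2 ⟨i⟩
    refine (measureReal_exists_le_abs_sum_range_le (fun j ↦ (hcoord_meas i).comp (hX j))
      (hindep.comp (fun _ v ↦ v i) fun _ ↦ hcoord_meas i)
      (fun j ↦ hasSubgaussianMGF_of_abs_le ((hcoord_meas i).comp (hX j)).aemeasurable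
        ((hbound j).mono fun ω hω ↦ (PiLp.norm_apply_le (X j ω) i).trans hω) (hcoord_mean i j))
      (hcoord_mean i) (div_pos hε (Real.sqrt_pos.2 hcard)) n).trans_eq ?_
    rw [div_pow, Real.sq_sqrt hcard.le, ← neg_div, div_div]
    congr 3
    ring
  have hsubset : {ω | ∃ k ≤ n, ε ≤ ‖∑ j ∈ Finset.range k, X j ω‖} ⊆
      ⋃ i, {ω | ∃ k ≤ n, δ ≤ |∑ j ∈ Finset.range k, X j ω i|} := by
    rintro ω ⟨k, hk, hεk⟩
    obtain ⟨i, hi⟩ := exists_div_sqrt_card_le_abs_apply hε hεk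
    exact mem_iUnion.2 ⟨i, k, hk, by simpa using hi⟩
  calc _ ≤ _ := measureReal_mono hsubset
    _ ≤ _ := measureReal_iUnion_fintype_le _
    _ ≤ _ := Finset.sum_le_sum fun i _ ↦ hcoord i
    _ = _ := by rw [Finset.sum_const, Finset.card_univ, nsmul_eq_mul]; ring

end Vector

end MaximalInequality

section GaussianTail

variable {Ω : Type*} {mΩ : MeasurableSpace Ω} {P : Measure Ω}

theorem integral_rpow_sub_one_mul_exp_neg_sq_div {p v : ℝ} (hp : 0 < p) (hv : 0 < v) :
    ∫ t in Ioi (0 : ℝ), t ^ (p - 1) * Real.exp (-t ^ 2 / v) =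
      Real.Gamma (p / 2 + 1) * v ^ (p / 2) / p := by
  have hgamma := integral_rpow_mul_exp_neg_mul_rpow two_pos (by linarith : -1 < p - 1)
    (inv_pos.2 hv)
  simp only [sub_add_cancel, Real.rpow_two] at hgamma
  rw [Real.inv_rpow hv.le, neg_div, Real.rpow_neg hv.le, inv_inv] at hgamma
  rw [Real.Gamma_add_one (by positivity)]
  convert hgamma using 1
  · simp only [neg_mul, div_eq_inv_mul, mul_neg]
  · field_simp

theorem lintegral_rpow_le_of_gaussian_tail [IsFiniteMeasure P] {U : Ω → ℝ} (hU : AEMeasurable U P)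
    (hnonneg : 0 ≤ U) {p A v : ℝ} (hp : 0 < p) (hA : 0 ≤ A) (hv : 0 < v)
    (htail : ∀ t : ℝ, 0 < t → P.real {ω | t ≤ U ω} ≤ A * Real.exp (-t ^ 2 / v)) :
    ∫⁻ ω, ENNReal.ofReal (U ω ^ p) ∂P ≤
      ENNReal.ofReal (A * Real.Gamma (p / 2 + 1) * v ^ (p / 2)) := by
  have hint : IntegrableOn (fun t : ℝ ↦ t ^ (p - 1) * Real.exp (-t ^ 2 / v)) (Ioi 0) := by
    simpa [neg_div, div_eq_inv_mul] using
      integrableOn_rpow_mul_exp_neg_mul_sq (inv_pos.2 hv) (by linarith : -1 < p - 1)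
  rw [lintegral_rpow_eq_lintegral_meas_le_mul P (ae_of_all _ hnonneg) hU hp]
  calc ENNReal.ofReal p * ∫⁻ t in Ioi 0, P {ω | t ≤ U ω} * ENNReal.ofReal (t ^ (p - 1))
      ≤ ENNReal.ofReal p * ∫⁻ t in Ioi (0 : ℝ), ENNReal.ofReal A *
          ENNReal.ofReal (t ^ (p - 1) * Real.exp (-t ^ 2 / v)) := by
        gcongr 1
        refine setLIntegral_mono' measurableSet_Ioi fun t (ht : 0 < t) ↦ ?_
        rw [← ofReal_measureReal, ← ENNReal.ofReal_mul measureReal_nonneg, ← ENNReal.ofReal_mul hA]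
        refine ENNReal.ofReal_le_ofReal ?_
        rw [mul_left_comm, mul_comm]
        gcongr
        exact htail t ht
    _ = ENNReal.ofReal (p * (A * ∫ t in Ioi (0 : ℝ), t ^ (p - 1) * Real.exp (-t ^ 2 / v))) := by
        rw [lintegral_const_mul' _ _ ENNReal.ofReal_ne_top,
          ← ofReal_integral_eq_lintegral_ofReal hint, ← ENNReal.ofReal_mul hA,
          ← ENNReal.ofReal_mul hp.le]
        filter_upwards [ae_restrict_mem measurableSet_Ioi] with t ht
        exact mul_nonneg (Real.rpow_nonneg (le_of_lt ht) _) (Real.exp_pos _).le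
    _ = _ := by
        rw [integral_rpow_sub_one_mul_exp_neg_sq_div hp hv]
        congr 1
        field_simp

theorem eLpNorm_le_of_gaussian_tail [IsFiniteMeasure P] {U : Ω → ℝ} (hU : AEMeasurable U P)
    (hnonneg : 0 ≤ U) {p A v : ℝ} (hp : 0 < p) (hA : 0 ≤ A) (hv : 0 < v)
    (htail : ∀ t : ℝ, 0 < t → P.real {ω | t ≤ U ω} ≤ A * Real.exp (-t ^ 2 / v)) :
    eLpNorm U (ENNReal.ofReal p) P ≤
      ENNReal.ofReal ((A * Real.Gamma (p / 2 + 1)) ^ (1 / p) * √v) := by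
  have hΓ : 0 ≤ Real.Gamma (p / 2 + 1) := (Real.Gamma_pos_of_pos (by positivity)).le
  have hroot : (A * Real.Gamma (p / 2 + 1)) ^ (1 / p) * √v =
      (A * Real.Gamma (p / 2 + 1) * v ^ (p / 2)) ^ (1 / p) := by
    rw [Real.mul_rpow (mul_nonneg hA hΓ) (by positivity), ← Real.rpow_mul hv.le, Real.sqrt_eq_rpow]
    congr 2
    field_simp
  rw [eLpNorm_eq_lintegral_rpow_enorm_toReal (by simpa using hp) ENNReal.ofReal_ne_top,
    ENNReal.toReal_ofReal hp.le, hroot,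
    ← ENNReal.ofReal_rpow_of_nonneg (by positivity) (by positivity)]
  gcongr
  refine le_of_eq_of_le (lintegral_congr fun ω ↦ ?_)
    (lintegral_rpow_le_of_gaussian_tail hU hnonneg hp hA hv htail)
  rw [Real.enorm_of_nonneg (hnonneg ω), ENNReal.ofReal_rpow_of_nonneg (hnonneg ω) hp.le]

end GaussianTail

section MaxNormSum

/-- The maximum `max_{k ≤ n} ‖x_0 + ⋯ + x_{k-1}‖` of the norms of the partial sums of a sequence,
in which the accumulated quadrature errors enter the error analysis. The empty sum is included. -/
noncomputable def maxNormSum {E : Type*} [SeminormedAddCommGroup E] (x : ℕ → E) (n : ℕ) : ℝ :=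
  (Finset.range (n + 1)).sup' Finset.nonempty_range_add_one fun k ↦ ‖∑ j ∈ Finset.range k, x j‖

section Basic

variable {E : Type*} [SeminormedAddCommGroup E] {x : ℕ → E} {n : ℕ}

theorem norm_sum_range_le_maxNormSum {k : ℕ} (hk : k ≤ n) :
    ‖∑ j ∈ Finset.range k, x j‖ ≤ maxNormSum x n :=
  Finset.le_sup' (fun k ↦ ‖∑ j ∈ Finset.range k, x j‖) (Finset.mem_range_succ_iff.2 hk)

theorem maxNormSum_nonneg : 0 ≤ maxNormSum x n :=
  (norm_nonneg (∑ j ∈ Finset.range 0, x j)).trans (norm_sum_range_le_maxNormSum n.zero_le)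

theorem le_maxNormSum_iff {ε : ℝ} :
    ε ≤ maxNormSum x n ↔ ∃ k ≤ n, ε ≤ ‖∑ j ∈ Finset.range k, x j‖ := by
  simp only [maxNormSum, Finset.le_sup'_iff, Finset.mem_range_succ_iff]

end Basic

variable {Ω : Type*} {mΩ : MeasurableSpace Ω} {P : Measure Ω}

theorem measurable_maxNormSum {E : Type*} [NormedAddCommGroup E] [MeasurableSpace E] [BorelSpace E]
    [SecondCountableTopology E] {X : ℕ → Ω → E} (hX : ∀ j, Measurable (X j)) (n : ℕ) :
    Measurable fun ω ↦ maxNormSum (fun j ↦ X j ω) n :=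
  Finset.measurable_range_sup'' fun _ _ ↦ (Finset.measurable_fun_sum _ fun j _ ↦ hX j).norm

/-- The constant of the `L^p` maximal inequality `eLpNorm_maxNormSum_le` in dimension `N`. -/
noncomputable def maximalConst (N : ℕ) (p : ℝ) : ℝ :=
  (2 * N * Real.Gamma (p / 2 + 1)) ^ (1 / p) * √(2 * N)

theorem maximalConst_nonneg (N : ℕ) {p : ℝ} (hp : 0 < p) : 0 ≤ maximalConst N p := by
  have := Real.Gamma_pos_of_pos (by positivity : 0 < p / 2 + 1)
  unfold maximalConst
  positivity

theorem eLpNorm_maxNormSum_le {ι : Type*} [Fintype ι] {X : ℕ → Ω → EuclideanSpace ℝ ι}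
    (hX : ∀ j, Measurable (X j)) (hindep : iIndepFun X P) (hmean : ∀ j, ∫ ω, X j ω ∂P = 0)
    {r : ℕ → ℝ≥0} (hbound : ∀ j, ∀ᵐ ω ∂P, ‖X j ω‖ ≤ r j) {n : ℕ}
    (hr : 0 < ∑ j ∈ Finset.range n, r j ^ 2) {p : ℝ} (hp : 0 < p) :
    eLpNorm (fun ω ↦ maxNormSum (fun j ↦ X j ω) n) (ENNReal.ofReal p) P ≤
      ENNReal.ofReal (maximalConst (Fintype.card ι) p *
        √(∑ j ∈ Finset.range n, r j ^ 2 : ℝ≥0)) := by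
  have := hindep.isProbabilityMeasure
  rcases isEmpty_or_nonempty ι with hι | hι
  · have hzero : ∀ x : ℕ → EuclideanSpace ℝ ι, maxNormSum x n = 0 := fun x ↦ by
      simp [maxNormSum, Subsingleton.elim (_ : EuclideanSpace ℝ ι) 0]
    simp [hzero]
  · rw [maximalConst, mul_assoc, ← Real.sqrt_mul (by positivity)]
    refine eLpNorm_le_of_gaussian_tail (measurable_maxNormSum hX n).aemeasurable
      (fun ω ↦ maxNormSum_nonneg) hp (by positivity) (by positivity) fun t ht ↦ ?_
    simpa only [le_maxNormSum_iff] using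
      measureReal_exists_le_norm_sum_range_le hX hindep hmean hbound ht n

end MaxNormSum

section Quadrature

variable {E : Type*} [NormedAddCommGroup E] [NormedSpace ℝ E] {φ : ℝ → E} {t h C : ℝ}

/-- The error `∫_t^{t+h} φ - h φ(t + h u)` of the one-point quadrature rule. Evaluated at a random
`u`, uniformly distributed on `[0,1]`, it has mean zero. -/
noncomputable def quadError (φ : ℝ → E) (t h u : ℝ) : E :=
  (∫ s in t..(t + h), φ s) - h • φ (t + h * u)

theorem continuous_quadError (hφ : Continuous φ) (t h : ℝ) : Continuous (quadError φ t h) := by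
  unfold quadError
  fun_prop

theorem integral_quadError [CompleteSpace E] (hφ : Continuous φ) (t h : ℝ) :
    ∫ u in (0 : ℝ)..1, quadError φ t h u = 0 := by
  have hint : IntervalIntegrable (fun u ↦ h • φ (t + h * u)) volume 0 1 :=
    Continuous.intervalIntegrable (by fun_prop) _ _
  simp only [quadError]
  rw [intervalIntegral.integral_sub intervalIntegrable_const hint,
    intervalIntegral.integral_const, intervalIntegral.integral_smul,
    intervalIntegral.smul_integral_comp_add_mul]
  simp

theorem norm_quadError_le [CompleteSpace E] (hφ : Continuous φ) (hh : 0 ≤ h) {u : ℝ}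
    (hC : ∀ s ∈ Icc t (t + h), ‖φ s - φ (t + h * u)‖ ≤ C) : ‖quadError φ t h u‖ ≤ C * h := by
  have hint : quadError φ t h u = ∫ s in t..(t + h), (φ s - φ (t + h * u)) := by
    rw [intervalIntegral.integral_sub (hφ.intervalIntegrable _ _) intervalIntegrable_const,
      intervalIntegral.integral_const, add_sub_cancel_left, quadError]
  rw [hint]
  refine (intervalIntegral.norm_integral_le_of_norm_le_const fun s hs ↦ hC s ?_).trans_eq
    (by rw [add_sub_cancel_left, abs_of_nonneg hh])
  rw [uIoc_of_le (by linarith)] at hs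
  exact Ioc_subset_Icc_self hs

theorem norm_sub_sub_integral_le [CompleteSpace E] {z z' : ℝ → E} (hh : 0 ≤ h) (hφ : Continuous φ)
    (hz : ∀ s ∈ Icc t (t + h), HasDerivWithinAt z (z' s) (Icc t (t + h)) s)
    (hC : ∀ s ∈ Icc t (t + h), ‖z' s - φ s‖ ≤ C) :
    ‖z (t + h) - z t - ∫ s in t..(t + h), φ s‖ ≤ C * h := by
  have hderiv : ∀ s ∈ Icc t (t + h),
      HasDerivWithinAt (fun s ↦ z s - ∫ r in t..s, φ r) (z' s - φ s) (Icc t (t + h)) s :=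
    fun s hs ↦ (hz s hs).sub (hφ.integral_hasStrictDerivAt t s).hasDerivAt.hasDerivWithinAt
  have hmvt := (convex_Icc t (t + h)).norm_image_sub_le_of_norm_hasDerivWithin_le hderiv hC
    (left_mem_Icc.2 (by linarith)) (right_mem_Icc.2 (by linarith))
  rwa [intervalIntegral.integral_same, sub_zero, add_sub_cancel_left, Real.norm_eq_abs,
    abs_of_nonneg hh, sub_right_comm] at hmvt

end Quadrature

section Grid

variable {a b : ℝ} {n k : ℕ}

theorem step_pos (hab : a < b) (hn : 1 ≤ n) : 0 < step a b n :=
  div_pos (sub_pos.2 hab) (by exact_mod_cast hn)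

theorem natCast_mul_step (hn : 1 ≤ n) : n * step a b n = b - a :=
  mul_div_cancel₀ _ (by positivity)

theorem natCast_mul_step_le (hab : a < b) (hn : 1 ≤ n) (hk : k ≤ n) :
    k * step a b n ≤ b - a := by
  rw [← natCast_mul_step (a := a) (b := b) hn]
  have := (step_pos hab hn).le
  gcongr

theorem step_le (hab : a < b) (hn : 1 ≤ n) : step a b n ≤ b - a := by
  simpa using natCast_mul_step_le hab hn hn

theorem grid_succ (a b : ℝ) (n k : ℕ) : grid a b n (k + 1) = grid a b n k + step a b n := by
  unfold grid; push_cast; ring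

theorem grid_mem_Icc (hab : a < b) (hn : 1 ≤ n) (hk : k ≤ n) : grid a b n k ∈ Icc a b := by
  have hle := natCast_mul_step_le hab hn hk
  have hnonneg := mul_nonneg (Nat.cast_nonneg (α := ℝ) k) (step_pos hab hn).le
  unfold grid
  exact ⟨by linarith, by linarith⟩

theorem add_step_mul_mem_Icc (hab : a < b) (hn : 1 ≤ n) (t : ℝ) {u : ℝ} (hu : u ∈ Icc (0 : ℝ) 1) :
    t + step a b n * u ∈ Icc t (t + step a b n) := by
  have hh := (step_pos hab hn).le
  exact ⟨by linarith [mul_nonneg hh hu.1], by linarith [mul_le_of_le_one_right hh hu.2]⟩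

theorem Icc_grid_subset (hab : a < b) (hk : k < n) :
    Icc (grid a b n k) (grid a b n k + step a b n) ⊆ Icc a b :=
  Icc_subset_Icc (grid_mem_Icc hab (by omega) hk.le).1
    (grid_succ a b n k ▸ (grid_mem_Icc hab (by omega) hk).2)

theorem node_mem_Icc (hab : a < b) (hk : k < n) {τ : ℕ → ℝ} (hτ : τ k ∈ Icc (0 : ℝ) 1) :
    node a b n τ k ∈ Icc a b :=
  Icc_grid_subset hab hk (add_step_mul_mem_Icc hab (by omega) _ hτ)

theorem sub_grid_mem_Icc (hab : a < b) (hn : 1 ≤ n) {t : ℝ} (ht : t ∈ Icc a b) :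
    t - grid a b n (min ⌊(t - a) / step a b n⌋₊ (n - 1)) ∈ Icc 0 (step a b n) := by
  have hh := step_pos hab hn
  set m := ⌊(t - a) / step a b n⌋₊
  have hfloor : m * step a b n ≤ t - a :=
    (le_div_iff₀ hh).1 (Nat.floor_le (div_nonneg (sub_nonneg.2 ht.1) hh.le))
  have hlt : t - a < (m + 1) * step a b n := (div_lt_iff₀ hh).1 (Nat.lt_floor_add_one _)
  unfold grid
  rcases le_or_gt m (n - 1) with hm | hm
  · rw [min_eq_left hm]
    constructor <;> linarith
  · have hlast : ((n - 1 : ℕ) : ℝ) * step a b n = b - a - step a b n := by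
      rw [← natCast_mul_step (a := a) (b := b) hn, Nat.cast_pred hn]
      ring
    have hmn : b - a ≤ m * step a b n := by
      rw [← natCast_mul_step (a := a) (b := b) hn]
      gcongr
      omega
    rw [min_eq_right hm.le, hlast]
    constructor <;> linarith [ht.2]

end Grid

theorem discrete_gronwall_of_lt {u : ℕ → ℝ} {β γ : ℝ} (hnonneg : ∀ k, 0 ≤ u k) (hβ : 0 ≤ β)
    (hγ : 0 ≤ γ) {n : ℕ} (hu : ∀ k < n, u (k + 1) ≤ (1 + γ) * u k + β) {k : ℕ} (hk : k ≤ n) :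
    u k ≤ (u 0 + k * β) * Real.exp (k * γ) := by
  have hrec : ∀ j ≥ 0, u (min (j + 1) n) ≤ (1 + γ) * u (min j n) + β := fun j _ ↦ by
    rcases lt_or_ge j n with hj | hj
    · rw [min_eq_left hj, min_eq_left hj.le]
      exact hu j hj
    · rw [min_eq_right hj, min_eq_right (by omega)]
      nlinarith [hnonneg n]
  simpa [min_eq_left hk] using discrete_gronwall (u := fun j ↦ u (min j n)) (b := fun _ ↦ β)
    (c := fun _ ↦ γ) (hnonneg _) hrec (fun _ _ ↦ hγ) (fun _ _ ↦ hβ) k.zero_le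

section Solution

variable {d : ℕ} {a b : ℝ} {f g : ℝ → EuclideanSpace ℝ (Fin d) → EuclideanSpace ℝ (Fin d)}
  {ξ : EuclideanSpace ℝ (Fin d)} {z w : ℝ → EuclideanSpace ℝ (Fin d)}

theorem IsSolution.continuousOn (hz : IsSolution a b f ξ z) : ContinuousOn z (Icc a b) :=
  fun t ht ↦ (hz.2 t ht).continuousWithinAt

theorem IsSolution.hasDerivWithinAt_Ici (hz : IsSolution a b f ξ z) {t : ℝ} (ht : t ∈ Ico a b) :
    HasDerivWithinAt z (f t (z t)) (Ici t) t :=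
  (hz.2 t (Ico_subset_Icc_self ht)).mono_of_mem_nhdsWithin (Icc_mem_nhdsGE_of_mem ht)

theorem IsSolution.norm_sub_le (hz : IsSolution a b f ξ z) {M : ℝ} (hM : ∀ t x, ‖f t x‖ ≤ M)
    {s t : ℝ} (hs : s ∈ Icc a b) (ht : t ∈ Icc a b) : ‖z t - z s‖ ≤ M * |t - s| :=
  (convex_Icc a b).norm_image_sub_le_of_norm_hasDerivWithin_le hz.2 (fun _ _ ↦ hM _ _) hs ht

/-- The common bound for the solution and the Euler iterates when the field satisfies
`‖f(t, y)‖ ≤ K (1 + ‖y‖)`. -/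
noncomputable def aPrioriBound (a b K : ℝ) (ξ : EuclideanSpace ℝ (Fin d)) : ℝ :=
  (1 + ‖ξ‖) * Real.exp (K * (b - a))

theorem aPrioriBound_pos (a b K : ℝ) (ξ : EuclideanSpace ℝ (Fin d)) : 0 < aPrioriBound a b K ξ := by
  unfold aPrioriBound
  positivity

theorem IsSolution.norm_le {K : ℝ} (hK : 0 ≤ K)
    (hgrowth : ∀ t ∈ Icc a b, ∀ y, ‖f t y‖ ≤ K * (1 + ‖y‖)) (hz : IsSolution a b f ξ z) {t : ℝ}
    (ht : t ∈ Icc a b) : ‖z t‖ ≤ aPrioriBound a b K ξ := by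
  have hgronwall := norm_le_gronwallBound_of_norm_deriv_right_le (δ := ‖ξ‖) (K := K) (ε := K)
    hz.continuousOn (fun s hs ↦ hz.hasDerivWithinAt_Ici hs) (by rw [hz.1])
    (fun s hs ↦ (hgrowth s (Ico_subset_Icc_self hs) _).trans_eq (by ring)) t ht
  have hbound : gronwallBound ‖ξ‖ K K (t - a) ≤ (1 + ‖ξ‖) * Real.exp (K * (t - a)) := by
    rcases eq_or_ne K 0 with rfl | hK0
    · simp [gronwallBound_K0]
    · rw [gronwallBound_of_K_ne_0 hK0, div_self hK0]
      linarith
  refine (hgronwall.trans hbound).trans ?_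
  unfold aPrioriBound
  gcongr
  exact ht.2

theorem IsSolution.congr_field (hz : IsSolution a b f ξ z)
    (hfg : ∀ t ∈ Icc a b, g t (z t) = f t (z t)) : IsSolution a b g ξ z :=
  ⟨hz.1, fun t ht ↦ hfg t ht ▸ hz.2 t ht⟩

theorem exists_isSolution (hab : a < b) (hg : Continuous (Function.uncurry g)) {L M : ℝ≥0}
    (hL : ∀ t, LipschitzWith L (g t)) (hM : ∀ t x, ‖g t x‖ ≤ M) (ξ : EuclideanSpace ℝ (Fin d)) :
    ∃ z, IsSolution a b g ξ z := by
  have hba : 0 ≤ b - a := sub_nonneg.2 hab.le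
  have hPicard : IsPicardLindelof g (tmin := a) (tmax := b) ⟨a, left_mem_Icc.2 hab.le⟩ ξ
      (M * (b - a).toNNReal) 0 M L :=
    { lipschitzOnWith := fun t _ ↦ (hL t).lipschitzOnWith
      continuousOn := fun x _ ↦ (hg.comp (Continuous.prodMk_left x)).continuousOn
      norm_le := fun t _ x _ ↦ hM t x
      mul_max_le := by simp [hba] }
  exact hPicard.exists_eq_forall_mem_Icc_hasDerivWithinAt₀

theorem IsSolution.eqOn
    (hLip : ∀ R : ℝ, 0 < R → ∃ L : ℝ, 0 ≤ L ∧ ∀ t ∈ Icc a b, ∀ x y,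
      ‖x‖ ≤ R → ‖y‖ ≤ R → ‖f t x - f t y‖ ≤ L * ‖x - y‖)
    (hw : IsSolution a b f ξ w) (hz : IsSolution a b f ξ z) : EqOn w z (Icc a b) := by
  obtain ⟨Rw, hRw⟩ := isCompact_Icc.exists_bound_of_continuousOn hw.continuousOn
  obtain ⟨Rz, hRz⟩ := isCompact_Icc.exists_bound_of_continuousOn hz.continuousOn
  set R := max 1 (max Rw Rz)
  obtain ⟨L, hL, hLR⟩ := hLip R (lt_max_of_lt_left one_pos)
  have hmem : ∀ {v : ℝ → EuclideanSpace ℝ (Fin d)} {R' : ℝ}, R' ≤ R →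
      (∀ t ∈ Icc a b, ‖v t‖ ≤ R') → ∀ t ∈ Ico a b, v t ∈ Metric.closedBall 0 R :=
    fun hR' hv t ht ↦ mem_closedBall_zero_iff.2 ((hv t (Ico_subset_Icc_self ht)).trans hR')
  refine ODE_solution_unique_of_mem_Icc_right (v := f) (s := fun _ ↦ Metric.closedBall 0 R)
    (K := L.toNNReal) (fun t ht ↦ LipschitzOnWith.of_dist_le_mul fun x hx y hy ↦ ?_)
    hw.continuousOn (fun _ ht ↦ hw.hasDerivWithinAt_Ici ht)
    (hmem ((le_max_left _ _).trans (le_max_right _ _)) hRw)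
    hz.continuousOn (fun _ ht ↦ hz.hasDerivWithinAt_Ici ht)
    (hmem ((le_max_right _ _).trans (le_max_right _ _)) hRz) (hw.1.trans hz.1.symm)
  rw [dist_eq_norm, dist_eq_norm, Real.coe_toNNReal _ hL]
  exact hLR t (Ico_subset_Icc_self ht) x y (mem_closedBall_zero_iff.1 hx)
    (mem_closedBall_zero_iff.1 hy)

end Solution

section ErrorRecursion

variable {d : ℕ} {a b ϱ H : ℝ} {g : ℝ → EuclideanSpace ℝ (Fin d) → EuclideanSpace ℝ (Fin d)}
  {ξ : EuclideanSpace ℝ (Fin d)} {z : ℝ → EuclideanSpace ℝ (Fin d)} {L M : ℝ≥0} {n k : ℕ}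

/-- The error, as a function of the value `u` of `τ_k`, of the randomized quadrature of
`s ↦ g(s, z(t_k))` on `[t_k, t_{k+1}]`. -/
noncomputable def gridQuadError (a b : ℝ)
    (g : ℝ → EuclideanSpace ℝ (Fin d) → EuclideanSpace ℝ (Fin d))
    (z : ℝ → EuclideanSpace ℝ (Fin d)) (n k : ℕ) (u : ℝ) : EuclideanSpace ℝ (Fin d) :=
  quadError (fun s ↦ g s (z (grid a b n k))) (grid a b n k) (step a b n) u

theorem continuous_gridQuadError (hg : Continuous (Function.uncurry g))
    (z : ℝ → EuclideanSpace ℝ (Fin d)) (n k : ℕ) : Continuous (gridQuadError a b g z n k) :=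
  continuous_quadError (hg.comp (Continuous.prodMk_left _)) _ _

theorem integral_gridQuadError (hg : Continuous (Function.uncurry g))
    (z : ℝ → EuclideanSpace ℝ (Fin d)) (n k : ℕ) :
    ∫ u in (0 : ℝ)..1, gridQuadError a b g z n k u = 0 :=
  integral_quadError (hg.comp (Continuous.prodMk_left _)) _ _

theorem norm_gridQuadError_le (hab : a < b) (hϱ : 0 ≤ ϱ) (hg : Continuous (Function.uncurry g))
    (hH0 : 0 ≤ H) (hH : ∀ t s x, ‖g t x - g s x‖ ≤ H * |t - s| ^ ϱ) (hn : 1 ≤ n) {u : ℝ}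
    (hu : u ∈ Icc (0 : ℝ) 1) :
    ‖gridQuadError a b g z n k u‖ ≤ H * step a b n ^ ϱ * step a b n := by
  refine norm_quadError_le (hg.comp (Continuous.prodMk_left _)) (step_pos hab hn).le
    fun s hs ↦ (hH _ _ _).trans ?_
  have hdist := abs_sub_le_of_le_of_le hs.1 hs.2
    (add_step_mul_mem_Icc hab hn (grid a b n k) hu).1
    (add_step_mul_mem_Icc hab hn (grid a b n k) hu).2
  gcongr
  simpa using hdist

theorem norm_solution_step_sub_integral_le (hab : a < b) (hg : Continuous (Function.uncurry g))
    (hL : ∀ t, LipschitzWith L (g t)) (hM : ∀ t x, ‖g t x‖ ≤ M) (hz : IsSolution a b g ξ z)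
    (hk : k < n) :
    ‖z (grid a b n (k + 1)) - z (grid a b n k) -
      ∫ s in grid a b n k..(grid a b n k + step a b n), g s (z (grid a b n k))‖ ≤
      L * (M * step a b n) * step a b n := by
  have hcell := Icc_grid_subset hab hk
  have hh := (step_pos hab (by omega : 1 ≤ n)).le
  rw [grid_succ]
  refine norm_sub_sub_integral_le hh (hg.comp (Continuous.prodMk_left _))
    (fun s hs ↦ (hz.2 s (hcell hs)).mono hcell) fun s hs ↦ ?_
  have hincr : ‖z s - z (grid a b n k)‖ ≤ M * step a b n := by
    refine (hz.norm_sub_le hM (grid_mem_Icc hab (by omega) hk.le) (hcell hs)).trans ?_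
    gcongr
    rw [abs_of_nonneg (by linarith [hs.1])]
    linarith [hs.2]
  exact ((hL s).norm_sub_le _ _).trans (by gcongr)

theorem norm_residual_succ_le (hab : a < b) (hg : Continuous (Function.uncurry g))
    (hL : ∀ t, LipschitzWith L (g t)) (hM : ∀ t x, ‖g t x‖ ≤ M) (hz : IsSolution a b g ξ z)
    (τ : ℕ → ℝ) (hk : k < n) (S : EuclideanSpace ℝ (Fin d)) :
    ‖z (grid a b n (k + 1)) - euler a b g ξ n τ (k + 1) - (S + gridQuadError a b g z n k (τ k))‖ ≤
      (1 + step a b n * L) * ‖z (grid a b n k) - euler a b g ξ n τ k - S‖ +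
        step a b n * L * (‖S‖ + M * step a b n) := by
  have hh := (step_pos hab (by omega : 1 ≤ n)).le
  set h := step a b n
  set θ := node a b n τ k
  set zk := z (grid a b n k)
  set y := euler a b g ξ n τ k
  have hsplit : z (grid a b n (k + 1)) - euler a b g ξ n τ (k + 1) -
      (S + gridQuadError a b g z n k (τ k)) = (zk - y - S) +
        (z (grid a b n (k + 1)) - zk - ∫ s in grid a b n k..(grid a b n k + h), g s zk) +
        h • (g θ zk - g θ y) := by
    simp only [euler, gridQuadError, quadError, smul_sub, θ, node, zk, y, h]
    abel
  have hlip : ‖h • (g θ zk - g θ y)‖ ≤ h * L * (‖zk - y - S‖ + ‖S‖) := by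
    rw [norm_smul, Real.norm_of_nonneg hh, mul_assoc]
    gcongr
    exact ((hL θ).norm_sub_le _ _).trans
      (by gcongr; simpa using norm_add_le (zk - y - S) S)
  rw [hsplit]
  linarith [norm_add₃_le (a := zk - y - S)
    (b := z (grid a b n (k + 1)) - zk - ∫ s in grid a b n k..(grid a b n k + h), g s zk)
    (c := h • (g θ zk - g θ y)), norm_solution_step_sub_integral_le hab hg hL hM hz hk]

/-- The factor by which Gronwall's inequality amplifies perturbations of an equation with Lipschitz
constant `L` over `[a,b]`. -/
noncomputable def gronwallFactor (a b : ℝ) (L : ℝ≥0) : ℝ :=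
  (b - a) * L * Real.exp ((b - a) * L)

theorem gronwallFactor_nonneg (hab : a < b) (L : ℝ≥0) : 0 ≤ gronwallFactor a b L := by
  have := sub_pos.2 hab
  unfold gronwallFactor
  positivity

theorem norm_solution_sub_euler_le (hab : a < b) (hg : Continuous (Function.uncurry g))
    (hL : ∀ t, LipschitzWith L (g t)) (hM : ∀ t x, ‖g t x‖ ≤ M) (hz : IsSolution a b g ξ z)
    (hn : 1 ≤ n) (τ : ℕ → ℝ) (hk : k ≤ n) :
    ‖z (grid a b n k) - euler a b g ξ n τ k‖ ≤
      (1 + gronwallFactor a b L) * maxNormSum (fun j ↦ gridQuadError a b g z n j (τ j)) n +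
        gronwallFactor a b L * M * step a b n := by
  have hh := (step_pos hab hn).le
  set D := maxNormSum (fun j ↦ gridQuadError a b g z n j (τ j)) n
  set S := fun k ↦ ∑ j ∈ Finset.range k, gridQuadError a b g z n j (τ j)
  have hD : 0 ≤ D := maxNormSum_nonneg
  have hS : ∀ k ≤ n, ‖S k‖ ≤ D := fun k hk ↦ norm_sum_range_le_maxNormSum hk
  set r := fun k ↦ ‖z (grid a b n k) - euler a b g ξ n τ k - S k‖
  have hrec : ∀ k < n, r (k + 1) ≤ (1 + step a b n * L) * r k +
      step a b n * L * (D + M * step a b n) := fun k hk ↦ by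
    simp only [r, S, Finset.sum_range_succ]
    refine (norm_residual_succ_le hab hg hL hM hz τ hk _).trans ?_
    gcongr
    exact hS k hk.le
  have hzero : r 0 = 0 := by simp [r, S, euler, grid, hz.1]
  have hr : r k ≤ gronwallFactor a b L * (D + M * step a b n) := by
    calc r k ≤ (r 0 + k * (step a b n * L * (D + M * step a b n))) *
          Real.exp (k * (step a b n * L)) :=
          discrete_gronwall_of_lt (u := r) (fun _ ↦ norm_nonneg _) (by positivity) (by positivity)
            hrec hk
      _ = k * step a b n * L * Real.exp (k * step a b n * L) * (D + M * step a b n) := by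
          rw [hzero]; ring_nf
      _ ≤ gronwallFactor a b L * (D + M * step a b n) := by
          unfold gronwallFactor
          have := sub_pos.2 hab
          gcongr <;> exact natCast_mul_step_le hab hn hk
  have htri : ‖z (grid a b n k) - euler a b g ξ n τ k‖ ≤ r k + ‖S k‖ := by
    simpa using norm_add_le (z (grid a b n k) - euler a b g ξ n τ k - S k) (S k)
  linarith [hS k hk]

theorem norm_solution_sub_interp_le (hab : a < b) (hg : Continuous (Function.uncurry g))
    (hL : ∀ t, LipschitzWith L (g t)) (hM : ∀ t x, ‖g t x‖ ≤ M) (hz : IsSolution a b g ξ z)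
    (hn : 1 ≤ n) (τ : ℕ → ℝ) {t : ℝ} (ht : t ∈ Icc a b) :
    ‖z t - interp a b g ξ n τ t‖ ≤
      (1 + gronwallFactor a b L) * maxNormSum (fun j ↦ gridQuadError a b g z n j (τ j)) n +
        (gronwallFactor a b L + 2) * M * step a b n := by
  have hcell := sub_grid_mem_Icc hab hn ht
  unfold interp piece
  set k := min ⌊(t - a) / step a b n⌋₊ (n - 1)
  have hk : k ≤ n := (min_le_right _ _).trans (Nat.sub_le _ _)
  have hdist : |t - grid a b n k| ≤ step a b n := (abs_of_nonneg hcell.1).trans_le hcell.2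
  set slope := g (node a b n τ k) (euler a b g ξ n τ k)
  have hsol : ‖z t - z (grid a b n k)‖ ≤ M * step a b n :=
    (hz.norm_sub_le hM (grid_mem_Icc hab hn hk) ht).trans (by gcongr)
  have hpiece : ‖(t - grid a b n k) • slope‖ ≤ M * step a b n := by
    rw [norm_smul, Real.norm_eq_abs, mul_comm]
    gcongr
    exact hM _ _
  have hsplit : z t - (euler a b g ξ n τ k + (t - grid a b n k) • slope) =
      (z t - z (grid a b n k)) + (z (grid a b n k) - euler a b g ξ n τ k) +
        -((t - grid a b n k) • slope) := by
    abel
  rw [hsplit]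
  refine norm_add₃_le.trans ?_
  rw [norm_neg]
  linarith [norm_solution_sub_euler_le hab hg hL hM hz hn τ hk]

theorem iSup_enorm_solution_sub_interp_le (hab : a < b) (hg : Continuous (Function.uncurry g))
    (hL : ∀ t, LipschitzWith L (g t)) (hM : ∀ t x, ‖g t x‖ ≤ M) (hz : IsSolution a b g ξ z)
    (hn : 1 ≤ n) (τ : ℕ → ℝ) :
    ⨆ t ∈ Icc a b, ‖z t - interp a b g ξ n τ t‖ₑ ≤ ENNReal.ofReal
      ((1 + gronwallFactor a b L) * maxNormSum (fun j ↦ gridQuadError a b g z n j (τ j)) n +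
        (gronwallFactor a b L + 2) * M * step a b n) := by
  refine iSup₂_le fun t ht ↦ ?_
  rw [← ofReal_norm]
  exact ENNReal.ofReal_le_ofReal (norm_solution_sub_interp_le hab hg hL hM hz hn τ ht)

end ErrorRecursion

section RadialRetraction

variable {E : Type*} [NormedAddCommGroup E] [NormedSpace ℝ E] {R : ℝ}

/-- The retraction of `E` onto the closed ball of radius `R > 0` along rays. -/
noncomputable def radialRetraction (R : ℝ) (x : E) : E := (R / max R ‖x‖) • x

theorem radialRetraction_of_norm_le (hR : 0 < R) {x : E} (hx : ‖x‖ ≤ R) :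
    radialRetraction R x = x := by
  rw [radialRetraction, max_eq_left hx, div_self hR.ne', one_smul]

theorem norm_radialRetraction (hR : 0 < R) (x : E) :
    ‖radialRetraction R x‖ = R / max R ‖x‖ * ‖x‖ := by
  rw [radialRetraction, norm_smul, Real.norm_of_nonneg (by positivity)]

theorem norm_radialRetraction_le (hR : 0 < R) (x : E) : ‖radialRetraction R x‖ ≤ R := by
  rw [norm_radialRetraction hR, div_mul_eq_mul_div]
  exact div_le_of_le_mul₀ (by positivity) hR.le (by gcongr; exact le_max_right _ _)

theorem norm_radialRetraction_le_norm (hR : 0 < R) (x : E) : ‖radialRetraction R x‖ ≤ ‖x‖ := by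
  rw [norm_radialRetraction hR]
  exact mul_le_of_le_one_left (norm_nonneg x) (div_le_one_of_le₀ (le_max_left _ _) (by positivity))

theorem lipschitzWith_radialRetraction (hR : 0 < R) :
    LipschitzWith 2 (radialRetraction R : E → E) := by
  refine LipschitzWith.of_dist_le_mul fun x y ↦ ?_
  set m := max R ‖x‖
  set m' := max R ‖y‖
  have hm : 0 < m := lt_max_of_lt_left hR
  have hm' : 0 < m' := lt_max_of_lt_left hR
  have hsplit : radialRetraction R x - radialRetraction R y =
      (R / m) • (x - y) + (R / m - R / m') • y := by
    simp only [radialRetraction, smul_sub, sub_smul, m, m']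
    abel
  have hfst : ‖(R / m) • (x - y)‖ ≤ ‖x - y‖ := by
    rw [norm_smul, Real.norm_of_nonneg (by positivity)]
    exact mul_le_of_le_one_left (norm_nonneg _) (div_le_one_of_le₀ (le_max_left _ _) hm.le)
  have hmax : |m' - m| ≤ ‖x - y‖ := by
    simp only [m, m', max_comm R, norm_sub_rev x y]
    exact (abs_max_sub_max_le_abs _ _ R).trans (abs_norm_sub_norm_le y x)
  have hsnd : ‖(R / m - R / m') • y‖ ≤ ‖x - y‖ := by
    calc ‖(R / m - R / m') • y‖ = R / m * (‖y‖ / m') * |m' - m| := by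
          rw [norm_smul, Real.norm_eq_abs, div_sub_div _ _ hm.ne' hm'.ne',
            mul_comm m R, ← mul_sub, abs_div, abs_mul, abs_of_pos hR, abs_of_pos (mul_pos hm hm')]
          field_simp
      _ ≤ 1 * 1 * ‖x - y‖ := by
          gcongr
          · exact div_le_one_of_le₀ (le_max_left _ _) hm.le
          · exact div_le_one_of_le₀ (le_max_right _ _) hm'.le
      _ = ‖x - y‖ := by ring
  rw [dist_eq_norm, dist_eq_norm, hsplit, NNReal.coe_ofNat]
  linarith [norm_add_le ((R / m) • (x - y)) ((R / m - R / m') • y)]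

end RadialRetraction

section Truncation

variable {d : ℕ} {a b : ℝ} {f g : ℝ → EuclideanSpace ℝ (Fin d) → EuclideanSpace ℝ (Fin d)}
  {ξ : EuclideanSpace ℝ (Fin d)} {K R : ℝ}

/-- The field `f` on `[a,b] × {‖x‖ ≤ R}`, extended to `ℝ × ℝ^d` by precomposing with retractions
onto the two factors. -/
noncomputable def truncate (hab : a < b) (R : ℝ)
    (f : ℝ → EuclideanSpace ℝ (Fin d) → EuclideanSpace ℝ (Fin d)) (t : ℝ)
    (x : EuclideanSpace ℝ (Fin d)) : EuclideanSpace ℝ (Fin d) :=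
  f (projIcc a b hab.le t) (radialRetraction R x)

theorem truncate_eq (hab : a < b) (hR : 0 < R) {t : ℝ} (ht : t ∈ Icc a b)
    {x : EuclideanSpace ℝ (Fin d)} (hx : ‖x‖ ≤ R) : truncate hab R f t x = f t x := by
  simp only [truncate, projIcc_of_mem hab.le ht, radialRetraction_of_norm_le hR hx]

theorem continuous_truncate (hab : a < b) (hR : 0 < R)
    (hf : ContinuousOn (Function.uncurry f) (Icc a b ×ˢ univ)) :
    Continuous (Function.uncurry (truncate hab R f)) := by
  have hretract : Continuous fun q : ℝ × EuclideanSpace ℝ (Fin d) ↦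
      ((projIcc a b hab.le q.1 : ℝ), radialRetraction R q.2) :=
    (continuous_subtype_val.comp (continuous_projIcc.comp continuous_fst)).prodMk
      ((lipschitzWith_radialRetraction hR).continuous.comp continuous_snd)
  exact hf.comp_continuous hretract fun q ↦ ⟨(projIcc a b hab.le q.1).2, mem_univ _⟩

theorem norm_truncate_le (hab : a < b) (hR : 0 < R) (hK : 0 ≤ K)
    (hgrowth : ∀ t ∈ Icc a b, ∀ y, ‖f t y‖ ≤ K * (1 + ‖y‖)) (t : ℝ)
    (x : EuclideanSpace ℝ (Fin d)) : ‖truncate hab R f t x‖ ≤ K * (1 + ‖x‖) :=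
  (hgrowth _ (projIcc a b hab.le t).2 _).trans
    (by gcongr; exact norm_radialRetraction_le_norm hR x)

theorem norm_truncate_le_mul_one_add_radius (hab : a < b) (hR : 0 < R) (hK : 0 ≤ K)
    (hgrowth : ∀ t ∈ Icc a b, ∀ y, ‖f t y‖ ≤ K * (1 + ‖y‖)) (t : ℝ)
    (x : EuclideanSpace ℝ (Fin d)) : ‖truncate hab R f t x‖ ≤ K * (1 + R) :=
  (hgrowth _ (projIcc a b hab.le t).2 _).trans (by gcongr; exact norm_radialRetraction_le hR x)

theorem lipschitzWith_truncate (hab : a < b) (hR : 0 < R) {L : ℝ≥0}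
    (hL : ∀ t ∈ Icc a b, ∀ x y, ‖x‖ ≤ R → ‖y‖ ≤ R → ‖f t x - f t y‖ ≤ L * ‖x - y‖) (t : ℝ) :
    LipschitzWith (L * 2) (truncate hab R f t) := by
  have hball : LipschitzOnWith L (f (projIcc a b hab.le t)) (Metric.closedBall 0 R) :=
    LipschitzOnWith.of_dist_le_mul fun x hx y hy ↦ by
      rw [dist_eq_norm, dist_eq_norm]
      exact hL _ (projIcc a b hab.le t).2 x y (mem_closedBall_zero_iff.1 hx)
        (mem_closedBall_zero_iff.1 hy)
  exact lipschitzOnWith_univ.1 (hball.comp (lipschitzWith_radialRetraction hR).lipschitzOnWith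
    fun x _ ↦ mem_closedBall_zero_iff.2 (norm_radialRetraction_le hR x))

theorem norm_truncate_sub_le (hab : a < b) (hR : 0 < R) {H ϱ : ℝ} (hϱ : 0 ≤ ϱ) (hH0 : 0 ≤ H)
    (hH : ∀ t ∈ Icc a b, ∀ s ∈ Icc a b, ∀ x, ‖x‖ ≤ R → ‖f t x - f s x‖ ≤ H * |t - s| ^ ϱ)
    (t s : ℝ) (x : EuclideanSpace ℝ (Fin d)) :
    ‖truncate hab R f t x - truncate hab R f s x‖ ≤ H * |t - s| ^ ϱ := by
  have hproj : |(projIcc a b hab.le t : ℝ) - projIcc a b hab.le s| ≤ |t - s| :=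
    abs_projIcc_sub_projIcc hab.le
  refine (hH _ (projIcc a b hab.le t).2 _ (projIcc a b hab.le s).2 _
    (norm_radialRetraction_le hR x)).trans ?_
  gcongr

theorem norm_euler_le (hab : a < b) (hK : 0 ≤ K) {n k : ℕ} (hn : 1 ≤ n) (hk : k ≤ n)
    (hgrowth : ∀ t ∈ Icc a b, ∀ y, ‖f t y‖ ≤ K * (1 + ‖y‖)) {τ : ℕ → ℝ}
    (hτ : ∀ j, τ j ∈ Icc (0 : ℝ) 1) :
    ‖euler a b f ξ n τ k‖ ≤ aPrioriBound a b K ξ := by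
  have hh := (step_pos hab hn).le
  have hrec : ∀ j < n, 1 + ‖euler a b f ξ n τ (j + 1)‖ ≤
      (1 + step a b n * K) * (1 + ‖euler a b f ξ n τ j‖) + 0 := fun j hj ↦ by
    have hincr : ‖step a b n • f (node a b n τ j) (euler a b f ξ n τ j)‖ ≤
        step a b n * (K * (1 + ‖euler a b f ξ n τ j‖)) := by
      rw [norm_smul, Real.norm_of_nonneg hh]
      gcongr
      exact hgrowth _ (node_mem_Icc hab hj (hτ j)) _
    rw [euler]
    linarith [norm_add_le (euler a b f ξ n τ j)
      (step a b n • f (node a b n τ j) (euler a b f ξ n τ j))]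
  calc ‖euler a b f ξ n τ k‖ ≤ 1 + ‖euler a b f ξ n τ k‖ := by linarith
    _ ≤ (1 + ‖ξ‖ + k * 0) * Real.exp (k * (step a b n * K)) :=
        discrete_gronwall_of_lt (u := fun k ↦ 1 + ‖euler a b f ξ n τ k‖)
          (fun _ ↦ by positivity) le_rfl (by positivity) hrec hk
    _ = (1 + ‖ξ‖) * Real.exp (K * (k * step a b n)) := by ring_nf
    _ ≤ aPrioriBound a b K ξ := by
        unfold aPrioriBound
        gcongr
        exact natCast_mul_step_le hab hn hk

theorem interp_congr_field (hab : a < b)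
    (hfg : ∀ t ∈ Icc a b, ∀ x, ‖x‖ ≤ R → g t x = f t x) {n : ℕ} (hn : 1 ≤ n) {τ : ℕ → ℝ}
    (hτ : ∀ j, τ j ∈ Icc (0 : ℝ) 1) (hR : ∀ k ≤ n, ‖euler a b f ξ n τ k‖ ≤ R) (t : ℝ) :
    interp a b g ξ n τ t = interp a b f ξ n τ t := by
  have heuler : ∀ k ≤ n, euler a b g ξ n τ k = euler a b f ξ n τ k := by
    intro k hk
    induction k with
    | zero => rfl
    | succ k ih =>
      rw [euler, euler, ih (by omega), hfg _ (node_mem_Icc hab hk (hτ k)) _ (hR k (by omega))]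
  have hk : min ⌊(t - a) / step a b n⌋₊ (n - 1) < n := by omega
  unfold interp piece
  rw [heuler _ hk.le, hfg _ (node_mem_Icc hab hk (hτ _)) _ (hR _ hk.le)]

theorem IsSolution.of_truncate (hab : a < b) (hK : 0 ≤ K)
    (hgrowth : ∀ t ∈ Icc a b, ∀ y, ‖f t y‖ ≤ K * (1 + ‖y‖)) {z : ℝ → EuclideanSpace ℝ (Fin d)}
    (hz : IsSolution a b (truncate hab (aPrioriBound a b K ξ) f) ξ z) : IsSolution a b f ξ z :=
  hz.congr_field fun _ ht ↦ (truncate_eq hab (aPrioriBound_pos a b K ξ) ht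
    (hz.norm_le hK
      (fun t _ ↦ norm_truncate_le hab (aPrioriBound_pos a b K ξ) hK hgrowth t) ht)).symm

theorem interp_truncate (hab : a < b) (hK : 0 ≤ K) {n : ℕ} (hn : 1 ≤ n)
    (hgrowth : ∀ t ∈ Icc a b, ∀ y, ‖f t y‖ ≤ K * (1 + ‖y‖)) {τ : ℕ → ℝ}
    (hτ : ∀ j, τ j ∈ Icc (0 : ℝ) 1) :
    interp a b (truncate hab (aPrioriBound a b K ξ) f) ξ n τ = interp a b f ξ n τ :=
  funext <| interp_congr_field hab
    (fun _ ht _ hx ↦ truncate_eq hab (aPrioriBound_pos a b K ξ) ht hx) hn hτ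
    fun _ hk ↦ norm_euler_le hab hK hn hk hgrowth hτ

end Truncation

section Measurability

variable {d : ℕ} {a b : ℝ} {g : ℝ → EuclideanSpace ℝ (Fin d) → EuclideanSpace ℝ (Fin d)}
  {ξ : EuclideanSpace ℝ (Fin d)}

theorem continuous_field_node_euler (hg : Continuous (Function.uncurry g)) {n k : ℕ}
    (heuler : Continuous fun τ ↦ euler a b g ξ n τ k) :
    Continuous fun τ : ℕ → ℝ ↦ g (node a b n τ k) (euler a b g ξ n τ k) := by
  have hnode : Continuous fun τ : ℕ → ℝ ↦ node a b n τ k := by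
    unfold node
    fun_prop
  exact hg.comp (hnode.prodMk heuler)

theorem continuous_euler (hg : Continuous (Function.uncurry g)) (n k : ℕ) :
    Continuous fun τ ↦ euler a b g ξ n τ k := by
  induction k with
  | zero => exact continuous_const
  | succ k ih => exact ih.add ((continuous_field_node_euler hg ih).const_smul (step a b n))

theorem continuous_interp (hg : Continuous (Function.uncurry g)) (n : ℕ) (t : ℝ) :
    Continuous fun τ ↦ interp a b g ξ n τ t :=
  (continuous_euler hg n _).add
    ((continuous_field_node_euler hg (continuous_euler hg n _)).const_smul
      (t - grid a b n (min ⌊(t - a) / step a b n⌋₊ (n - 1))))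

theorem measurable_iSup_error (hg : Continuous (Function.uncurry g))
    (z : ℝ → EuclideanSpace ℝ (Fin d)) (n : ℕ) :
    Measurable fun τ : ℕ → ℝ ↦ ⨆ t ∈ Icc a b, ‖z t - interp a b g ξ n τ t‖ₑ :=
  LowerSemicontinuous.measurable <| lowerSemicontinuous_biSup fun t _ ↦
    (continuous_enorm.comp (continuous_const.sub (continuous_interp hg n t))).lowerSemicontinuous

end Measurability

section Uniform

variable {Ω : Type*} [MeasurableSpace Ω] {P : Measure Ω} {T : Ω → ℝ}

theorem map_eq_restrict_of_isUniform (hu : pdf.IsUniform T (Icc 0 1) P volume) :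
    P.map T = volume.restrict (Icc (0 : ℝ) 1) := by
  rw [hu, ProbabilityTheory.cond]
  simp

theorem ae_mem_Icc_of_isUniform (hu : pdf.IsUniform T (Icc 0 1) P volume) :
    ∀ᵐ ω ∂P, T ω ∈ Icc (0 : ℝ) 1 := by
  refine ae_of_ae_map (hu.aemeasurable (by simp) (by simp)) ?_
  rw [map_eq_restrict_of_isUniform hu]
  exact ae_restrict_mem measurableSet_Icc

theorem integral_comp_of_isUniform {E : Type*} [NormedAddCommGroup E] [NormedSpace ℝ E]
    (hu : pdf.IsUniform T (Icc 0 1) P volume) {φ : ℝ → E} (hφ : Continuous φ) :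
    ∫ ω, φ (T ω) ∂P = ∫ u in (0 : ℝ)..1, φ u := by
  rw [← integral_map (hu.aemeasurable (by simp) (by simp)) hφ.aestronglyMeasurable,
    map_eq_restrict_of_isUniform hu, integral_Icc_eq_integral_Ioc,
    intervalIntegral.integral_of_le zero_le_one]

end Uniform

theorem ae_iSup_error_truncate_eq {d : ℕ} {a b K : ℝ} (hab : a < b) (hK : 0 ≤ K)
    {f : ℝ → EuclideanSpace ℝ (Fin d) → EuclideanSpace ℝ (Fin d)} {ξ : EuclideanSpace ℝ (Fin d)}
    (hgrowth : ∀ t ∈ Icc a b, ∀ y, ‖f t y‖ ≤ K * (1 + ‖y‖)) {Ω : Type*} [MeasurableSpace Ω]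
    {P : Measure Ω} {τ : ℕ → Ω → ℝ}
    (hτu : ∀ j, pdf.IsUniform (τ j) (Icc 0 1) P volume) (z : ℝ → EuclideanSpace ℝ (Fin d)) {n : ℕ}
    (hn : 1 ≤ n) :
    (fun ω ↦ ⨆ t ∈ Icc a b, ‖z t -
        interp a b (truncate hab (aPrioriBound a b K ξ) f) ξ n (fun j ↦ τ j ω) t‖ₑ) =ᵐ[P]
      fun ω ↦ ⨆ t ∈ Icc a b, ‖z t - interp a b f ξ n (fun j ↦ τ j ω) t‖ₑ := by
  filter_upwards [ae_all_iff.2 fun j ↦ ae_mem_Icc_of_isUniform (hτu j)] with ω hω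
  rw [interp_truncate hab hK hn hgrowth hω]

section Rates

theorem rpow_le_mul_rpow {h B s m : ℝ} (hh : 0 < h) (hB : h ≤ B) (hms : m ≤ s) :
    h ^ s ≤ B ^ (s - m) * h ^ m := by
  calc h ^ s = h ^ (s - m) * h ^ m := by rw [← Real.rpow_add hh, sub_add_cancel]
    _ ≤ B ^ (s - m) * h ^ m := by
      have : 0 ≤ s - m := sub_nonneg.2 hms
      gcongr

theorem sqrt_natCast_mul_step {a b : ℝ} (hab : a < b) {n : ℕ} (hn : 1 ≤ n) (ϱ : ℝ) :
    √n * (step a b n ^ ϱ * step a b n) = √(b - a) * step a b n ^ (ϱ + 1 / 2) := by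
  have hh := step_pos hab hn
  rw [← natCast_mul_step (a := a) (b := b) hn, Real.sqrt_mul (Nat.cast_nonneg n), Real.rpow_add hh,
    ← Real.sqrt_eq_rpow]
  nth_rewrite 2 [← Real.mul_self_sqrt hh.le]
  ring

/-- The constant of the error bound for a field that is Lipschitz with constant `L`, bounded by `M`
and Hölder continuous with constant `H`. The powers of `b - a` come from replacing the exponents
`ϱ + 1/2` and `1` of the step size by their minimum. -/
noncomputable def errorConst (d : ℕ) (a b ϱ p : ℝ) (L M : ℝ≥0) (H : ℝ) : ℝ :=
  (1 + gronwallFactor a b L) * (maximalConst d p * H * √(b - a)) *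
      (b - a) ^ (ϱ + 1 / 2 - min (ϱ + 1 / 2) 1) +
    (gronwallFactor a b L + 2) * M * (b - a) ^ (1 - min (ϱ + 1 / 2) 1)

variable {d : ℕ} {a b ϱ p H : ℝ} {L M : ℝ≥0}

theorem errorConst_nonneg (hab : a < b) (hp : 0 < p) (hH : 0 ≤ H) :
    0 ≤ errorConst d a b ϱ p L M H := by
  have := sub_pos.2 hab
  have hG := gronwallFactor_nonneg hab L
  have hA := maximalConst_nonneg d hp
  unfold errorConst
  positivity

theorem add_le_errorConst_mul (hab : a < b) (hp : 0 < p) (hH : 0 ≤ H) {n : ℕ} (hn : 1 ≤ n) :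
    (1 + gronwallFactor a b L) *
        (maximalConst d p * H * √(b - a) * step a b n ^ (ϱ + 1 / 2)) +
        (gronwallFactor a b L + 2) * M * step a b n ≤
      errorConst d a b ϱ p L M H * step a b n ^ min (ϱ + 1 / 2) 1 := by
  have hG := gronwallFactor_nonneg hab L
  have hA := maximalConst_nonneg d hp
  have hrandom := rpow_le_mul_rpow (step_pos hab hn) (step_le hab hn)
    (min_le_left (ϱ + 1 / 2) 1)
  have hdrift := rpow_le_mul_rpow (step_pos hab hn) (step_le hab hn)
    (min_le_right (ϱ + 1 / 2) 1)
  rw [Real.rpow_one] at hdrift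
  calc _ ≤ (1 + gronwallFactor a b L) * (maximalConst d p * H * √(b - a) *
            ((b - a) ^ (ϱ + 1 / 2 - min (ϱ + 1 / 2) 1) * step a b n ^ min (ϱ + 1 / 2) 1)) +
          (gronwallFactor a b L + 2) * M *
            ((b - a) ^ (1 - min (ϱ + 1 / 2) 1) * step a b n ^ min (ϱ + 1 / 2) 1) := by gcongr
    _ = _ := by rw [errorConst]; ring

variable {g : ℝ → EuclideanSpace ℝ (Fin d) → EuclideanSpace ℝ (Fin d)}
  {ξ : EuclideanSpace ℝ (Fin d)} {z : ℝ → EuclideanSpace ℝ (Fin d)}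
  {Ω : Type*} [MeasurableSpace Ω] {P : Measure Ω} {τ : ℕ → Ω → ℝ} {n : ℕ}

theorem eLpNorm_maxNormSum_gridQuadError_le (hab : a < b) (hϱ : 0 ≤ ϱ) (hp : 0 < p)
    (hg : Continuous (Function.uncurry g)) (hH0 : 0 < H)
    (hH : ∀ t s x, ‖g t x - g s x‖ ≤ H * |t - s| ^ ϱ) (hτm : ∀ j, Measurable (τ j))
    (hτu : ∀ j, pdf.IsUniform (τ j) (Icc 0 1) P volume) (hτi : iIndepFun τ P) (hn : 1 ≤ n) :
    eLpNorm (fun ω ↦ maxNormSum (fun j ↦ gridQuadError a b g z n j (τ j ω)) n)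
        (ENNReal.ofReal p) P ≤
      ENNReal.ofReal (maximalConst d p * H * √(b - a) * step a b n ^ (ϱ + 1 / 2)) := by
  have hh := step_pos hab hn
  have hmeas : ∀ j, Measurable (gridQuadError a b g z n j) := fun j ↦
    (continuous_gridQuadError hg z n j).measurable
  have hmean : ∀ j, ∫ ω, gridQuadError a b g z n j (τ j ω) ∂P = 0 := fun j ↦ by
    rw [integral_comp_of_isUniform (hτu j) (continuous_gridQuadError hg z n j),
      integral_gridQuadError hg]
  set r : ℝ≥0 := (H * step a b n ^ ϱ * step a b n).toNNReal
  have hr : (r : ℝ) = H * step a b n ^ ϱ * step a b n := Real.coe_toNNReal _ (by positivity)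
  have : 0 < r := Real.toNNReal_pos.2 (by positivity)
  have hbound : ∀ j, ∀ᵐ ω ∂P, ‖gridQuadError a b g z n j (τ j ω)‖ ≤ r := fun j ↦
    (ae_mem_Icc_of_isUniform (hτu j)).mono fun ω hω ↦
      hr ▸ norm_gridQuadError_le hab hϱ hg hH0.le hH hn hω
  have hsum : √(∑ _j ∈ Finset.range n, r ^ 2 : ℝ≥0) =
      H * (√(b - a) * step a b n ^ (ϱ + 1 / 2)) := by
    rw [← sqrt_natCast_mul_step hab hn]
    simp only [Finset.sum_const, Finset.card_range, nsmul_eq_mul, NNReal.coe_mul,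
      NNReal.coe_natCast, NNReal.coe_pow]
    rw [Real.sqrt_mul n.cast_nonneg, Real.sqrt_sq r.coe_nonneg, hr]
    ring
  refine (eLpNorm_maxNormSum_le (fun j ↦ (hmeas j).comp (hτm j)) (hτi.comp _ hmeas) hmean hbound
    (Finset.sum_pos (fun _ _ ↦ by positivity) (by simpa using by omega)) hp).trans_eq ?_
  rw [hsum, Fintype.card_fin]
  ring_nf

theorem eLpNorm_iSup_error_le (hab : a < b) (hϱ : 0 ≤ ϱ) (hp : 1 ≤ p)
    (hg : Continuous (Function.uncurry g)) (hL : ∀ t, LipschitzWith L (g t))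
    (hM : ∀ t x, ‖g t x‖ ≤ M) (hH0 : 0 < H) (hH : ∀ t s x, ‖g t x - g s x‖ ≤ H * |t - s| ^ ϱ)
    (hz : IsSolution a b g ξ z) (hτm : ∀ j, Measurable (τ j))
    (hτu : ∀ j, pdf.IsUniform (τ j) (Icc 0 1) P volume) (hτi : iIndepFun τ P) (hn : 1 ≤ n) :
    eLpNorm (fun ω ↦ ⨆ t ∈ Icc a b, ‖z t - interp a b g ξ n (fun j ↦ τ j ω) t‖ₑ)
        (ENNReal.ofReal p) P ≤
      ENNReal.ofReal (errorConst d a b ϱ p L M H * step a b n ^ min (ϱ + 1 / 2) 1) := by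
  have hprob := hτi.isProbabilityMeasure
  have hh := step_pos hab hn
  have hp0 : 0 < p := by linarith
  have := sub_pos.2 hab
  have hA := maximalConst_nonneg d hp0
  have hG := gronwallFactor_nonneg hab L
  set G := gronwallFactor a b L
  set D : Ω → ℝ := fun ω ↦ maxNormSum (fun j ↦ gridQuadError a b g z n j (τ j ω)) n
  have hD : Measurable D := measurable_maxNormSum
    (fun j ↦ (continuous_gridQuadError hg z n j).measurable.comp (hτm j)) n
  set drift : Ω → ℝ := fun _ ↦ (G + 2) * M * step a b n
  have hpathwise : ∀ ω, ‖⨆ t ∈ Icc a b, ‖z t - interp a b g ξ n (fun j ↦ τ j ω) t‖ₑ‖ₑ ≤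
      ‖((1 + G) • D + drift) ω‖ₑ := fun ω ↦ by
    have hnonneg : 0 ≤ D ω := maxNormSum_nonneg
    rw [enorm_eq_self,
      Real.enorm_of_nonneg (by simp only [Pi.add_apply, Pi.smul_apply]; positivity)]
    exact iSup_enorm_solution_sub_interp_le hab hg hL hM hz hn _
  calc eLpNorm _ (ENNReal.ofReal p) P ≤ eLpNorm ((1 + G) • D + drift) (ENNReal.ofReal p) P :=
        eLpNorm_mono_enorm hpathwise
    _ ≤ eLpNorm ((1 + G) • D) (ENNReal.ofReal p) P + eLpNorm drift (ENNReal.ofReal p) P :=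
        eLpNorm_add_le (hD.const_smul _).aestronglyMeasurable aestronglyMeasurable_const
          (by simpa using hp)
    _ ≤ ENNReal.ofReal ((1 + G) * (maximalConst d p * H * √(b - a) * step a b n ^ (ϱ + 1 / 2))) +
        ENNReal.ofReal ((G + 2) * M * step a b n) := by
        rw [eLpNorm_const_smul, Real.enorm_of_nonneg (by positivity),
          ENNReal.ofReal_mul (by positivity), eLpNorm_const _ (by positivity) hprob.ne_zero,
          measure_univ, ENNReal.one_rpow, mul_one, Real.enorm_of_nonneg (by positivity)]
        gcongr
        exact eLpNorm_maxNormSum_gridQuadError_le hab hϱ hp0 hg hH0 hH hτm hτu hτi hn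
    _ ≤ _ := by
        rw [← ENNReal.ofReal_add (by positivity) (by positivity)]
        exact ENNReal.ofReal_le_ofReal (add_le_errorConst_mul hab hp0 hH0.le hn)

end Rates

end RandEuler

open RandEuler in
theorem mainTheorem6_general {d : ℕ} {a b : ℝ} (hab : a < b)
    (f : ℝ → EuclideanSpace ℝ (Fin d) → EuclideanSpace ℝ (Fin d))
    (ξ : EuclideanSpace ℝ (Fin d)) (ϱ : ℝ) (hϱ : 0 ≤ ϱ) (p : ℝ) (hp : 1 ≤ p)
    (hA1 : ContinuousOn (Function.uncurry f) (Icc a b ×ˢ univ))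
    (hA2 : ∃ K : ℝ, 0 ≤ K ∧ ∀ t ∈ Icc a b, ∀ y, ‖f t y‖ ≤ K * (1 + ‖y‖))
    (hA3 : ∀ R : ℝ, 0 < R → ∃ L : ℝ, 0 ≤ L ∧ ∀ t ∈ Icc a b, ∀ x y,
      ‖x‖ ≤ R → ‖y‖ ≤ R → ‖f t x - f t y‖ ≤ L * ‖x - y‖)
    (hA4 : ∀ H : ℝ, 0 < H → ∃ L : ℝ, 0 ≤ L ∧ ∀ t ∈ Icc a b, ∀ s ∈ Icc a b, ∀ x,
      ‖x‖ ≤ H → ‖f t x - f s x‖ ≤ L * |t - s| ^ ϱ)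
    {Ω : Type*} [MeasurableSpace Ω] (P : Measure Ω) (τ : ℕ → Ω → ℝ)
    (hτm : ∀ j, Measurable (τ j))
    (hτu : ∀ j, pdf.IsUniform (τ j) (Icc 0 1) P volume) (hτi : iIndepFun τ P) :
    ∃ z : ℝ → EuclideanSpace ℝ (Fin d),
      (IsSolution a b f ξ z ∧
        ∀ w, IsSolution a b f ξ w → EqOn w z (Icc a b)) ∧
      ∃ C : ℝ, 0 ≤ C ∧ ∀ n : ℕ, 1 ≤ n →
        AEMeasurable
          (fun ω ↦ ⨆ t ∈ Icc a b, ‖z t - interp a b f ξ n (fun j ↦ τ j ω) t‖ₑ) P ∧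
        eLpNorm
          (fun ω ↦ ⨆ t ∈ Icc a b, ‖z t - interp a b f ξ n (fun j ↦ τ j ω) t‖ₑ)
          (ENNReal.ofReal p) P ≤
          ENNReal.ofReal (C * step a b n ^ min (ϱ + 1 / 2) 1) := by
  obtain ⟨K, hK, hgrowth⟩ := hA2
  set R := aPrioriBound a b K ξ
  have hR : 0 < R := aPrioriBound_pos a b K ξ
  obtain ⟨L, hL0, hL⟩ := hA3 R hR
  obtain ⟨H, hH0, hH⟩ := hA4 R hR
  lift L to NNReal using hL0
  obtain ⟨M, hM⟩ : ∃ M : NNReal, ∀ t x, ‖truncate hab R f t x‖ ≤ M :=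
    ⟨⟨K * (1 + R), by positivity⟩, norm_truncate_le_mul_one_add_radius hab hR hK hgrowth⟩
  have hcont := continuous_truncate hab hR hA1
  have hlip := lipschitzWith_truncate hab hR hL
  have hholder := norm_truncate_sub_le hab hR hϱ (by positivity : 0 ≤ H + 1)
    fun t ht s hs x hx ↦ (hH t ht s hs x hx).trans (by gcongr; linarith)
  obtain ⟨z, hz⟩ := exists_isSolution hab hcont hlip hM ξ
  have hzf := hz.of_truncate hab hK hgrowth
  refine ⟨z, ⟨hzf, fun w hw ↦ hw.eqOn hA3 hzf⟩, errorConst d a b ϱ p (L * 2) M (H + 1),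
    errorConst_nonneg hab (by linarith) (by positivity), fun n hn ↦ ?_⟩
  have herror := ae_iSup_error_truncate_eq (ξ := ξ) hab hK hgrowth hτu z hn
  exact ⟨((measurable_iSup_error hcont z n).comp (measurable_pi_lambda _ hτm)).aemeasurable.congr
    herror, (eLpNorm_congr_ae herror).symm.trans_le <|
      eLpNorm_iSup_error_le hab hϱ hp hcont hlip hM (by positivity) hholder hz hτm hτu hτi hn⟩

theorem mainTheorem6 {d : ℕ} {a b : ℝ} (hab : a < b)
    (f : ℝ → EuclideanSpace ℝ (Fin d) → EuclideanSpace ℝ (Fin d))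
    (ξ : EuclideanSpace ℝ (Fin d)) (ϱ : ℝ) (hϱ : ϱ ∈ Ioc (0 : ℝ) 1)
    (p : ℝ) (hp : 2 ≤ p)
    -- `f` is continuous on `[a,b] × ℝ^d`
    (hA1 : ContinuousOn (Function.uncurry f) (Icc a b ×ˢ univ))
    -- linear growth
    (hA2 : ∃ K : ℝ, 0 ≤ K ∧ ∀ t ∈ Icc a b, ∀ y, ‖f t y‖ ≤ K * (1 + ‖y‖))
    -- local Lipschitz condition in the space variable
    (hA3 : ∀ R : ℝ, 0 < R → ∃ L : ℝ, 0 ≤ L ∧ ∀ t ∈ Icc a b, ∀ x y,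
      ‖x‖ ≤ R → ‖y‖ ≤ R → ‖f t x - f t y‖ ≤ L * ‖x - y‖)
    -- Hölder condition in time, locally uniformly in the space variable
    (hA4 : ∀ H : ℝ, 0 < H → ∃ L : ℝ, 0 ≤ L ∧ ∀ t ∈ Icc a b, ∀ s ∈ Icc a b, ∀ x,
      ‖x‖ ≤ H → ‖f t x - f s x‖ ≤ L * |t - s| ^ ϱ)
    {Ω : Type*} [MeasurableSpace Ω] (P : Measure Ω) [IsProbabilityMeasure P]
    -- an i.i.d. sequence, uniformly distributed on `[0,1]`
    (τ : ℕ → Ω → ℝ) (hτm : ∀ j, Measurable (τ j))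
    (hτu : ∀ j, pdf.IsUniform (τ j) (Icc 0 1) P volume)
    (hτi : iIndepFun τ P) :
    ∃ z : ℝ → EuclideanSpace ℝ (Fin d),
      -- `z` is the unique solution on `[a,b]`
      (RandEuler.IsSolution a b f ξ z ∧
        ∀ w, RandEuler.IsSolution a b f ξ w → EqOn w z (Icc a b)) ∧
      ∃ C : ℝ, 0 ≤ C ∧ ∀ n : ℕ, 1 ≤ n →
        AEMeasurable
          (fun ω ↦ ⨆ t ∈ Icc a b, ‖z t - RandEuler.interp a b f ξ n (fun j ↦ τ j ω) t‖ₑ) P ∧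
        eLpNorm
          (fun ω ↦ ⨆ t ∈ Icc a b, ‖z t - RandEuler.interp a b f ξ n (fun j ↦ τ j ω) t‖ₑ)
          (ENNReal.ofReal p) P ≤
          ENNReal.ofReal (C * RandEuler.step a b n ^ min (ϱ + 1 / 2) 1) := by
  exact mainTheorem6_general hab f ξ ϱ hϱ.1.le p (by linarith) hA1 hA2 hA3 hA4 P τ hτm hτu hτi
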